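/- **Setting.** There are $M$ sources. Source $m\in\{1,\dots,M\}$ is a Markov chain $(X^m_t)_{t\ge 1}$ on a finite non-empty set $\mathcal X^m$ with transition matrix $\mathbf Q^m$, which is irreducible and aperiodic (equivalently, some power of $\mathbf Q^m$ has only positive entries). The sources evolve independently. In each slot an agent chooses an action $a\in\mathcal A=\{0,1,\dots,M\}$: $a=0$ means staying idle, and $a=m\ne 0$ means sampling source $m$ and transmitting the sample, which is received with probability $p_s\in(0,1]$, independently of everything else. The delay is $d\in\{0,1\}$ slots. The receiver's estimate is $\hat X^m_t=X^m_{t-d}$ if $a_{t-d}=m$ and that transmission succeeded, and $\hat X^m_t=\hat X^m_{t-1}$ otherwise. The system state is $S_t=(X_t,\hat X_{t-1})$ if $d=0$ and $S_t=(X_t,\hat X_t)$ if $d=1$, and $\mathcal S=\prod_m(\mathcal X^m\times\mathcal X^m)$. In both cases the transition probabilities are $P(s'|s,a)=\prod_m P^m(s'(m)|s(m),a)$, where, from $s(m)=(i,j)$, the source moves to $k$ with probability $\mathbf Q^m_{i,k}$ and, independently, the estimate stays $j$ if $a\ne m$, while if $a=m$ it becomes $i$ with probability $p_s$ and stays $j$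 with probability $1-p_s$. The costs are $c(S_t,A_t,S_{t+1})=\sum_m\omega_m\,\delta^m(X^m_{t+d},\hat X^m_{t+d})$ with $\delta^m\ge 0$ and real weights $\omega_m$, $f(S_t,A_t)=\mathbf 1(A_t\neq 0)$, and $l^\lambda=c+\lambda f$. Let $\Pi$ be the set of all (history-dependent, randomized, possibly non-stationary) policies and $\Pi^{\mathrm{MD}}\subset\Pi$ the stationary Markov deterministic ones, i.e. the maps $\mathcal S\to\mathcal A$. For $\pi\in\Pi$ and an initial state $s$ let $$C_s(\pi)=\limsup_{T\to\infty}\frac1T\sum_{t=1}^T\mathbb E^\pi[c(S_t,A_t,S_{t+1})\mid S_1=s],$$ and let $F_s(\pi)$ and $\mathcal L^\lambda_s(\pi)$ be defined in the same way with $f$ and $l^\lambda$ in place of $c$. A policy $\pi\in\Pi$ is called $\lambda$-optimal if $\mathcal L^\lambda_s(\pi)=\inf_{\pi'\in\Pi}\mathcal L^\lambda_s(\pi')$ for every $s\in\mathcal S$ and none of $\mathcal L_s^\lambda(\pi)$, $C_s(\pi)$, $F_s(\pi)$ depends on $s$. **Theorem.** Let $\lambda\ge 0$. 1. There are real numbers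 $\mathcal L^\lambda, C^\lambda, F^\lambda$, a vector $h^\lambda\in\mathbb R^{\mathcal S}$ and a stationary Markov deterministic policy $\pi^*_\lambda\in\Pi^{\mathrm{MD}}$ such that the Bellman optimality equation $$\mathcal L^\lambda+h^\lambda(s)=\min_{a\in\mathcal A}\sum_{s'\in\mathcal S}P(s'|s,a)\bigl(l^\lambda(s,a,s')+h^\lambda(s')\bigr)\qquad(s\in\mathcal S)$$ holds, $\pi^*_\lambda(s)$ attains the minimum on the right-hand side for every $s$, $\pi^*_\lambda$ is $\lambda$-optimal, and for all $s\in\mathcal S$ we have $\mathcal L^\lambda_s(\pi^*_\lambda)=\mathcal L^\lambda$, $C_s(\pi^*_\lambda)=C^\lambda$ and $F_s(\pi^*_\lambda)=F^\lambda$, independently of $s$, with $\mathcal L^\lambda=C^\lambda+\lambda F^\lambda$. 2. For every solution $(\mathcal L,h)$ of the Bellman optimality equation, $\mathcal L=\min_{\pi\in\Pi}\mathcal L^\lambda_s(\pi)$ for every $s\in\mathcal S$, and every $\pi\in\Pi^{\mathrm{MD}}$ such that $\pi(s)$ attains the minimum in the equation for every $s$ satisfies $\mathcal L^\lambda_s(\pi)=\mathcal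 L$ for every $s$. -/

import Mathlib

open Filter Finset

noncomputable section

/-- Transmission delay of the channel, in slots: `d = 0` or `d = 1`. -/
inductive Delay
  | zero
  | one

/-- The data of the remote estimation system: `M` finite Markov sources observed over one lossy
channel. -/
structure RemoteSystem where
  /-- number of sources -/
  M : ℕ
  /-- number of states of each source -/
  N : Fin M → ℕ
  N_pos : ∀ m, 0 < N m
  /-- transition matrix of each source -/
  Q : ∀ m, Matrix (Fin (N m)) (Fin (N m)) ℝ
  Q_stochastic : ∀ m, Q m ∈ Matrix.rowStochastic ℝ (Fin (N m))
  /-- success probability of a transmission -/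
  ps : ℝ
  ps_nonneg : 0 ≤ ps
  ps_le_one : ps ≤ 1
  /-- delay -/
  d : Delay
  /-- control cost `δ m i j` of source `m` being in state `i` while its estimate is `j` -/
  δ : ∀ m, Fin (N m) → Fin (N m) → ℝ
  δ_nonneg : ∀ m i j, 0 ≤ δ m i j
  /-- relative significance of the sources -/
  ω : Fin M → ℝ

namespace RemoteSystem

variable (sys : RemoteSystem)

/-- State of one subsystem: (source state, estimate). -/
abbrev SubState (m : Fin sys.M) : Type := Fin (sys.N m) × Fin (sys.N m)

/-- State of the whole system. With zero delay it is `(X t, Xhat (t-1))`, with one-slot delay it is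
`(X t, Xhat t)`. -/
abbrev State : Type := ∀ m : Fin sys.M, sys.SubState m

/-- Actions: `0` means staying idle, `m.succ` means sampling and transmitting source `m`. -/
abbrev Action : Type := Fin (sys.M + 1)

/-- Transition probability of subsystem `m` from `x = (i, j)` to `y` under action `a`. -/
def subKernel (m : Fin sys.M) (a : sys.Action) (x y : sys.SubState m) : ℝ :=
  if a = m.succ ∧ x.1 ≠ x.2 ∧ y.2 = x.1 then sys.Q m x.1 y.1 * sys.ps
  else if a = m.succ ∧ x.1 ≠ x.2 ∧ y.2 = x.2 then sys.Q m x.1 y.1 * (1 - sys.ps)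
  else if a = m.succ ∧ x.1 = x.2 ∧ y.2 = x.1 then sys.Q m x.1 y.1
  else if a ≠ m.succ ∧ y.2 = x.2 then sys.Q m x.1 y.1
  else 0

/-- Transition probability `P(s' | s, a)` of the system. -/
def kernel (s : sys.State) (a : sys.Action) (s' : sys.State) : ℝ :=
  ∏ m, sys.subKernel m a (s m) (s' m)

/-- Cost of actuation error `∑ m, ω m * δ m (X (t+d), Xhat (t+d))` of a transition from `S t = s` to
`S (t+1) = s'`. With zero delay, `X t` is read off `s` and `Xhat t` off `s'`. With one-slot delay,
both `X (t+1)` and `Xhat (t+1)` are read off `s'`. -/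
def actCost (s : sys.State) (_a : sys.Action) (s' : sys.State) : ℝ :=
  match sys.d with
  | Delay.zero => ∑ m, sys.ω m * sys.δ m (s m).1 (s' m).2
  | Delay.one => ∑ m, sys.ω m * sys.δ m (s' m).1 (s' m).2

/-- Transmission cost (it does not depend on the next state). -/
def txCost (_s : sys.State) (a : sys.Action) (_s' : sys.State) : ℝ :=
  if a = 0 then 0 else 1

/-- Lagrangian instantaneous cost with multiplier `lam`. -/
def lagCost (lam : ℝ) (s : sys.State) (a : sys.Action) (s' : sys.State) : ℝ :=
  sys.actCost s a s' + lam * sys.txCost s a s'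

/-- Histories after `t` transitions: all states up to and including the current one, and all
earlier actions. -/
def Hist : ℕ → Type
  | 0 => sys.State
  | t + 1 => Hist t × sys.Action × sys.State

instance instFintypeHist : (t : ℕ) → Fintype (sys.Hist t)
  | 0 => inferInstanceAs (Fintype sys.State)
  | t + 1 =>
    letI := instFintypeHist t
    inferInstanceAs (Fintype (sys.Hist t × sys.Action × sys.State))

/-- The current state of a history. -/
def cur : (t : ℕ) → sys.Hist t → sys.State
  | 0, s => s
  | _ + 1, (_, _, s) => s

/-- General policies: history-dependent, randomized, non-stationary. -/
structure Policy where
  prob : (t : ℕ) → sys.Hist t → sys.Action → ℝ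
  prob_nonneg : ∀ t h a, 0 ≤ prob t h a
  prob_sum : ∀ t h, ∑ a, prob t h a = 1

/-- Stationary Markovian deterministic policies. -/
abbrev MDPolicy : Type := sys.State → sys.Action

variable {sys}

/-- A stationary Markovian deterministic policy, as a general policy. -/
def MDPolicy.toPolicy (π : sys.MDPolicy) : sys.Policy where
  prob t h a := if a = π (sys.cur t h) then 1 else 0
  prob_nonneg t h a := by split_ifs <;> norm_num
  prob_sum t h := by simp

namespace Policy

variable (π : sys.Policy)

/-- Law of the history after `t` transitions under `π`, started in state `s`. -/
def law (s : sys.State) : (t : ℕ) → sys.Hist t → ℝ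
  | 0, h => if sys.cur 0 h = s then 1 else 0
  | t + 1, (h, a, s') => law s t h * π.prob t h a * sys.kernel (sys.cur t h) a s'

/-- Expectation, under `π` and started in `s`, of the cost `g` incurred in the transition that
follows the first `t` transitions. -/
def expCost (g : sys.State → sys.Action → sys.State → ℝ) (s : sys.State) (t : ℕ) : ℝ :=
  ∑ h : sys.Hist t, ∑ a, ∑ s',
    π.law s t h * π.prob t h a * sys.kernel (sys.cur t h) a s' * g (sys.cur t h) a s'

/-- Limsup average cost of `π` for the instantaneous cost `g`, started in `s`. -/
def avgCost (g : sys.State → sys.Action → sys.State → ℝ) (s : sys.State) : ℝ :=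
  limsup (fun T : ℕ => (∑ t ∈ range T, π.expCost g s t) / (T : ℝ)) atTop

/-- Average cost of actuation error `C_s(π)`. -/
def avgC (s : sys.State) : ℝ := π.avgCost sys.actCost s

/-- Average transmission cost `F_s(π)`. -/
def avgF (s : sys.State) : ℝ := π.avgCost sys.txCost s

/-- Lagrangian average cost. -/
def avgL (lam : ℝ) (s : sys.State) : ℝ := π.avgCost (sys.lagCost lam) s

/-- `π` solves the Lagrangian MDP, for every initial state and among all policies, and its three
average costs do not depend on the initial state. -/
structure IsLambdaOptimal (lam : ℝ) : Prop where
  optimal : ∀ s, ∀ π' : sys.Policy, π.avgL lam s ≤ π'.avgL lam s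
  const_L : ∀ s s', π.avgL lam s = π.avgL lam s'
  const_C : ∀ s s', π.avgC s = π.avgC s'
  const_F : ∀ s s', π.avgF s = π.avgF s'

end Policy

variable (sys)

/-- The expression minimized over `a` in the Bellman equation. -/
def bellmanQ (lam : ℝ) (h : sys.State → ℝ) (s : sys.State) (a : sys.Action) : ℝ :=
  ∑ s', sys.kernel s a s' * (sys.lagCost lam s a s' + h s')

/-- `(L, h)` solves the average-cost Bellman optimality equation. -/
def IsBellmanSolution (lam L : ℝ) (h : sys.State → ℝ) : Prop :=
  ∀ s, L + h s = (univ : Finset sys.Action).inf' univ_nonempty (sys.bellmanQ lam h s)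

/-- `π s` is a minimizer in the Bellman equation at every state `s`. -/
def IsBellmanSelector (lam : ℝ) (h : sys.State → ℝ) (π : sys.MDPolicy) : Prop :=
  ∀ s a, sys.bellmanQ lam h s (π s) ≤ sys.bellmanQ lam h s a

end RemoteSystem

end

/-! The system is a communicating finite MDP. Idling freezes every estimate while the primitive
sources reach any joint state, and an estimate takes a prescribed value once its source has moved
there and is transmitted successfully (`RemoteSystem.reachable`). Communication bounds the
oscillation of discounted values uniformly in the discount factor (`exists_forall_sub_le`), so a
limit at discount factor one solves the Bellman equation (`exists_bellman`). Taking expectations and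
telescoping turns the Bellman inequality into a lower bound for every policy, with equality for
minimizers.

The delicate point is that the two costs are constant separately: a minimizer may have several
recurrent classes, on which only the Lagrangian average is forced to agree. The remedy is to solve
the equation for multipliers `lam + 1 / (n + 1)`. There are finitely many deterministic policies, so
one minimizes for infinitely many `n`, and by the uniform bounds it also minimizes for a limit
solution at `lam`. Two of its multipliers give two independent linear relations, which determine
both mean costs for every initial state. -/

/-- A bounded real sequence converges along every ultrafilter. -/
theorem exists_tendsto_ultrafilter_of_abs_le (U : Ultrafilter ℕ) {u : ℕ → ℝ} {B : ℝ}
    (hu : ∀ n, |u n| ≤ B) : ∃ l, |l| ≤ B ∧ Tendsto u U (nhds l) := by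
  have hle : (U.map u : Filter ℝ) ≤ 𝓟 (Set.Icc (-B) B) := by
    rw [le_principal_iff]
    exact Ultrafilter.mem_map.2 (univ_mem' fun n => abs_le.1 (hu n))
  obtain ⟨l, hl, h⟩ := isCompact_Icc.ultrafilter_le_nhds (U.map u) hle
  exact ⟨l, abs_le.2 hl, h⟩

theorem Ultrafilter.exists_eventually_eq_of_finite {α : Type*} [Finite α] (U : Ultrafilter ℕ)
    (u : ℕ → α) : ∃ a, ∀ᶠ n in U, u n = a := by
  obtain ⟨a, -, ha⟩ := (Ultrafilter.finite_biUnion_mem_iff (f := U) Set.finite_univ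
    (s := fun a => u ⁻¹' {a})).1 (univ_mem' fun n => by simp)
  exact ⟨a, ha⟩

/-! ### Communicating finite MDPs and the vanishing discount limit -/

section FiniteMDP

variable {S A : Type*} [Fintype S]

/-- Comparison of the values of a one-step subharmonic function along a path of transitions of
positive probability. -/
theorem exists_sub_le_of_reachable {P : S → A → S → ℝ} (hP0 : ∀ x a y, 0 ≤ P x a y)
    (hP1 : ∀ x a, ∑ y, P x a y = 1) {x z : S}
    (hxz : Relation.ReflTransGen (fun x y => ∃ a, 0 < P x a y) x z) :
    ∃ K : ℝ, 0 ≤ K ∧ ∀ (v : S → ℝ) (B M : ℝ), 0 ≤ B → (∀ y, v y ≤ M) →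
      (∀ y a, v y ≤ B + ∑ y', P y a y' * v y') → M - v z ≤ K * (B + (M - v x)) := by
  induction hxz with
  | refl => exact ⟨1, zero_le_one, fun v B M hB _ _ => by linarith⟩
  | @tail y z _ hyz ih =>
    obtain ⟨K, hK, ih⟩ := ih
    obtain ⟨a, ha⟩ := hyz
    -- Averaging `M - v` over the transition from `y` gives `P y a z * (M - v z) ≤ B + (M - v y)`,
    -- and the induction hypothesis bounds the right side by `(K + 1) * (B + (M - v x))`.
    refine ⟨(K + 1) / P y a z, by positivity, fun v B M hB hM hv => ?_⟩
    have h1 := ih v B M hB hM hv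
    have h2 := hv y a
    have h3 : P y a z * (M - v z) ≤ ∑ y', P y a y' * (M - v y') :=
      single_le_sum (f := fun y' => P y a y' * (M - v y'))
        (fun y' _ => mul_nonneg (hP0 _ _ _) (by linarith [hM y'])) (mem_univ z)
    have h4 : ∑ y', P y a y' * (M - v y') = M - ∑ y', P y a y' * v y' := by
      simp only [mul_sub, sum_sub_distrib, ← sum_mul, hP1, one_mul]
    rw [div_mul_eq_mul_div, le_div_iff₀ ha]
    nlinarith [hM x]

/-- In a communicating finite MDP one-step subharmonic functions have bounded oscillation. -/
theorem exists_forall_sub_le [Nonempty S] {P : S → A → S → ℝ} (hP0 : ∀ x a y, 0 ≤ P x a y)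
    (hP1 : ∀ x a, ∑ y, P x a y = 1)
    (hcomm : ∀ x z, Relation.ReflTransGen (fun x y => ∃ a, 0 < P x a y) x z) :
    ∃ K : ℝ, 0 ≤ K ∧ ∀ (v : S → ℝ) (B : ℝ), 0 ≤ B →
      (∀ y a, v y ≤ B + ∑ y', P y a y' * v y') → ∀ x z, v x - v z ≤ K * B := by
  choose K hK h using fun x z => exists_sub_le_of_reachable hP0 hP1 (hcomm x z)
  refine ⟨∑ x, ∑ z, K x z, sum_nonneg fun x _ => sum_nonneg fun z _ => hK x z,
    fun v B hB hv x z => ?_⟩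
  -- Paths start at a maximizer, where the term `M - v x` vanishes.
  obtain ⟨m, hm⟩ := Finite.exists_max v
  have h1 := h m z v B (v m) hB hm hv
  have h2 : K m z ≤ ∑ x, ∑ z, K x z :=
    (single_le_sum (f := fun z => K m z) (fun z _ => hK m z) (mem_univ z)).trans
      (single_le_sum (f := fun x => ∑ z, K x z)
        (fun x _ => sum_nonneg fun z _ => hK x z) (mem_univ m))
  have h3 := mul_le_mul_of_nonneg_right h2 hB
  rw [sub_self, add_zero] at h1
  linarith [hm x]

variable [Fintype A] [Nonempty A]

/-- The discounted Bellman equation has a solution. -/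
theorem exists_discounted_value {P : S → A → S → ℝ} (hP0 : ∀ x a y, 0 ≤ P x a y)
    (hP1 : ∀ x a, ∑ y, P x a y = 1) (r : S → A → ℝ) {β : ℝ} (hβ0 : 0 ≤ β) (hβ1 : β < 1) :
    ∃ (v : S → ℝ) (p : S → A), (∀ s, v s = r s (p s) + β * ∑ y, P s (p s) y * v y) ∧
      ∀ s a, v s ≤ r s a + β * ∑ y, P s a y * v y := by
  classical
  let q : (S → ℝ) → S → A → ℝ := fun v s a => r s a + β * ∑ y, P s a y * v y
  have hq : ∀ v w s a, q v s a ≤ q w s a + β * dist v w := by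
    intro v w s a
    have : ∑ y, P s a y * v y ≤ ∑ y, P s a y * (w y + dist v w) := by
      refine sum_le_sum fun y _ => mul_le_mul_of_nonneg_left ?_ (hP0 _ _ _)
      have := (le_abs_self _).trans ((Real.dist_eq (v y) (w y)).symm.le.trans
        (dist_le_pi_dist v w y))
      linarith
    simp only [mul_add, sum_add_distrib, ← sum_mul, hP1, one_mul] at this
    have := mul_le_mul_of_nonneg_left this hβ0
    simp only [q]
    linarith
  let T : (S → ℝ) → S → ℝ := fun v s => univ.inf' univ_nonempty (q v s)
  have hT : ∀ v w s, T v s ≤ T w s + β * dist v w := by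
    intro v w s
    obtain ⟨a, -, ha⟩ := exists_mem_eq_inf' univ_nonempty (q w s)
    have h1 : T v s ≤ q v s a := inf'_le _ (mem_univ a)
    have h2 : T w s = q w s a := ha
    linarith [hq v w s a]
  have hc : ContractingWith ⟨β, hβ0⟩ T := by
    refine ⟨by exact_mod_cast hβ1, LipschitzWith.of_dist_le_mul fun v w => ?_⟩
    change _ ≤ β * _
    rw [dist_pi_le_iff (mul_nonneg hβ0 dist_nonneg)]
    intro s
    rw [Real.dist_eq, abs_le]
    have h1 := hT v w s
    have h2 := hT w v s
    rw [dist_comm] at h2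
    constructor <;> linarith
  have hfix : T hc.fixedPoint = hc.fixedPoint := hc.fixedPoint_isFixedPt
  set v := hc.fixedPoint
  have hex : ∀ s, ∃ a, v s = q v s a := fun s => by
    obtain ⟨a, -, ha⟩ := exists_mem_eq_inf' univ_nonempty (q v s)
    exact ⟨a, by rw [← ha]; exact (congrFun hfix s).symm⟩
  choose p hp using hex
  refine ⟨v, p, hp, fun s a => ?_⟩
  rw [← hfix]
  have : T v s ≤ q v s a := inf'_le _ (mem_univ a)
  rw [hfix]
  rw [hfix] at this
  exact this

/-- Average-cost Bellman equation of a communicating MDP with nonnegative costs, with a bound on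
the solution that is uniform in the cost. -/
theorem exists_bellman_of_nonneg [Nonempty S] {P : S → A → S → ℝ} (hP0 : ∀ x a y, 0 ≤ P x a y)
    (hP1 : ∀ x a, ∑ y, P x a y = 1)
    (hcomm : ∀ x z, Relation.ReflTransGen (fun x y => ∃ a, 0 < P x a y) x z) :
    ∃ K : ℝ, 0 ≤ K ∧ ∀ (r : S → A → ℝ) (B : ℝ), (∀ s a, 0 ≤ r s a) → (∀ s a, r s a ≤ B) →
      ∃ (L : ℝ) (h : S → ℝ) (p : S → A), |L| ≤ B ∧ (∀ s, |h s| ≤ K * B) ∧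
        (∀ s, L + h s = r s (p s) + ∑ y, P s (p s) y * h y) ∧
        ∀ s a, L + h s ≤ r s a + ∑ y, P s a y * h y := by
  obtain ⟨K, hK, hosc⟩ := exists_forall_sub_le hP0 hP1 hcomm
  refine ⟨K, hK, fun r B hr0 hrB => ?_⟩
  obtain ⟨x₀⟩ := ‹Nonempty S›
  obtain ⟨a₀⟩ := ‹Nonempty A›
  have : Nonempty S := ⟨x₀⟩
  have : Nonempty A := ⟨a₀⟩
  have hB : 0 ≤ B := (hr0 x₀ a₀).trans (hrB x₀ a₀)
  let β : ℕ → ℝ := fun n => 1 - 1 / ((n : ℝ) + 1)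
  have hβ0 : ∀ n, 0 ≤ β n := fun n => by
    simp only [β, sub_nonneg]
    rw [div_le_one (by positivity)]
    linarith [n.cast_nonneg (α := ℝ)]
  have hβ1 : ∀ n, β n < 1 := fun n => by
    have : 0 < 1 / ((n : ℝ) + 1) := by positivity
    simp only [β]; linarith
  choose v p hv hle using fun n => exists_discounted_value hP0 hP1 r (hβ0 n) (hβ1 n)
  have hmul : ∀ n s a (c : ℝ), ∑ y, P s a y * (v n y - c) = ∑ y, P s a y * v n y - c :=
    fun n s a c => by simp only [mul_sub, sum_sub_distrib, ← sum_mul, hP1, one_mul]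
  have hnn : ∀ n s, 0 ≤ v n s := by
    intro n s
    obtain ⟨m, hm⟩ := Finite.exists_min (v n)
    have h1 : 0 ≤ ∑ y, P m (p n m) y * (v n y - v n m) :=
      sum_nonneg fun y _ => mul_nonneg (hP0 _ _ _) (by linarith [hm y])
    rw [hmul] at h1
    have h2 := hv n m
    have h3 := mul_le_mul_of_nonneg_left h1 (hβ0 n)
    have : 0 ≤ v n m := by
      by_contra hneg
      nlinarith [hβ1 n, hr0 m (p n m)]
    exact this.trans (hm s)
  have hub : ∀ n s, (1 - β n) * v n s ≤ B := by
    intro n s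
    obtain ⟨m, hm⟩ := Finite.exists_max (v n)
    have h1 : ∑ y, P m (p n m) y * (v n y - v n m) ≤ 0 :=
      sum_nonpos fun y _ => mul_nonpos_of_nonneg_of_nonpos (hP0 _ _ _) (by linarith [hm y])
    rw [hmul] at h1
    have h3 := mul_le_mul_of_nonneg_left h1 (hβ0 n)
    have h4 := mul_le_mul_of_nonneg_left (hm s) (sub_nonneg.2 (hβ1 n).le)
    linarith [hv n m, hrB m (p n m)]
  -- Nonnegativity of `v n` allows the factor `β n` to be dropped, so `v n` is subharmonic up to an
  -- error `B` that does not depend on `n`.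
  have hspan : ∀ n x z, v n x - v n z ≤ K * B := fun n => by
    refine hosc (v n) B hB fun y a => ?_
    have h1 := hle n y a
    have h2 : 0 ≤ ∑ y', P y a y' * v n y' := sum_nonneg fun y' _ => mul_nonneg (hP0 _ _ _) (hnn n _)
    have h3 := mul_le_mul_of_nonneg_right (hβ1 n).le h2
    linarith [hrB y a]
  -- One ultrafilter makes all coordinates converge and freezes the policy simultaneously, with no
  -- subsequences to extract.
  let U : Ultrafilter ℕ := hyperfilter ℕ
  have hU : (U : Filter ℕ) ≤ atTop := Nat.hyperfilter_le_atTop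
  obtain ⟨L, hL, hLt⟩ := exists_tendsto_ultrafilter_of_abs_le U
    (u := fun n => (1 - β n) * v n x₀) (B := B) fun n => by
      rw [abs_of_nonneg (mul_nonneg (sub_nonneg.2 (hβ1 n).le) (hnn n _))]; exact hub n _
  choose h hh hht using fun s => exists_tendsto_ultrafilter_of_abs_le U
    (u := fun n => v n s - v n x₀) (B := K * B) fun n => by
      rw [abs_le]; constructor <;> linarith [hspan n s x₀, hspan n x₀ s]
  obtain ⟨p₀, hp₀⟩ := U.exists_eventually_eq_of_finite p
  have hβt : Tendsto β U (nhds 1) := by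
    have := (tendsto_one_div_add_atTop_nhds_zero_nat (𝕜 := ℝ)).const_sub 1
    rw [sub_zero] at this
    exact this.mono_left hU
  -- The left side is `v n s - β n * v n x₀`: the discounted equation with `v n x₀` subtracted
  -- inside the expectation.
  have hlhs : ∀ s, Tendsto (fun n => (1 - β n) * v n x₀ + (v n s - v n x₀)) U (nhds (L + h s)) :=
    fun s => hLt.add (hht s)
  have hrhs : ∀ s a, Tendsto (fun n => r s a + β n * ∑ y, P s a y * (v n y - v n x₀)) U
      (nhds (r s a + ∑ y, P s a y * h y)) := fun s a => by
    have h1 : Tendsto (fun n => ∑ y, P s a y * (v n y - v n x₀)) U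
        (nhds (∑ y, P s a y * h y)) := tendsto_finsetSum _ fun y _ => (hht y).const_mul _
    simpa using (hβt.mul h1).const_add (r s a)
  refine ⟨L, h, p₀, hL, hh, fun s => ?_, fun s a => ?_⟩
  · refine tendsto_nhds_unique_of_eventuallyEq (hlhs s) (hrhs s (p₀ s)) ?_
    filter_upwards [hp₀] with n hn
    have := hv n s
    rw [hn] at this
    rw [hmul]
    linarith
  · refine le_of_tendsto_of_tendsto' (hlhs s) (hrhs s a) fun n => ?_
    rw [hmul]
    linarith [hle n s a]

/-- Average-cost Bellman equation of a communicating MDP, with a bound on the solution that is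
uniform in the cost. -/
theorem exists_bellman [Nonempty S] {P : S → A → S → ℝ} (hP0 : ∀ x a y, 0 ≤ P x a y)
    (hP1 : ∀ x a, ∑ y, P x a y = 1)
    (hcomm : ∀ x z, Relation.ReflTransGen (fun x y => ∃ a, 0 < P x a y) x z) :
    ∃ K : ℝ, 0 ≤ K ∧ ∀ (r : S → A → ℝ) (B : ℝ), (∀ s a, |r s a| ≤ B) →
      ∃ (L : ℝ) (h : S → ℝ) (p : S → A), |L| ≤ K * B ∧ (∀ s, |h s| ≤ K * B) ∧
        (∀ s, L + h s = r s (p s) + ∑ y, P s (p s) y * h y) ∧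
        ∀ s a, L + h s ≤ r s a + ∑ y, P s a y * h y := by
  obtain ⟨K, hK, hex⟩ := exists_bellman_of_nonneg hP0 hP1 hcomm
  -- Adding `B` puts the costs in `[0, 2 * B]` and shifts only `L`; undoing the shift costs one more
  -- `B`.
  refine ⟨2 * K + 3, by positivity, fun r B hr => ?_⟩
  obtain ⟨x₀⟩ := ‹Nonempty S›
  obtain ⟨a₀⟩ := ‹Nonempty A›
  have hB : 0 ≤ B := (abs_nonneg _).trans (hr x₀ a₀)
  obtain ⟨L, h, p, hL, hh, heq, hle⟩ := hex (fun s a => r s a + B) (2 * B)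
    (fun s a => by linarith [(abs_le.1 (hr s a)).1]) (fun s a => by linarith [(abs_le.1 (hr s a)).2])
  have hKB : 0 ≤ K * B := mul_nonneg hK hB
  refine ⟨L - B, h, p, ?_, fun s => (hh s).trans (by linarith), fun s => by linarith [heq s],
    fun s a => by linarith [hle s a]⟩
  rw [abs_le] at hL ⊢
  constructor <;> linarith

end FiniteMDP

/-! ### Primitive stochastic matrices -/

namespace Matrix

variable {n : Type*} [Fintype n] [DecidableEq n] {A : Matrix n n ℝ}

theorem exists_pos_of_mem_rowStochastic (hA : A ∈ rowStochastic ℝ n) (i : n) : ∃ j, 0 < A i j := by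
  by_contra! h
  have h1 := sum_row_of_mem_rowStochastic hA i
  have h2 : ∑ j, A i j ≤ 0 := sum_nonpos fun j _ => h j
  linarith

/-- Each row has a positive entry, so positivity of a power passes to the next one. This permits one
common exponent for all sources. -/
theorem IsPrimitive.exists_forall_pow_pos (hA : A ∈ rowStochastic ℝ n) (hp : A.IsPrimitive) :
    ∃ k, ∀ l, k ≤ l → ∀ i j, 0 < (A ^ l) i j := by
  obtain ⟨-, k, -, hk⟩ := hp
  refine ⟨k, fun l hl => ?_⟩
  induction l, hl using Nat.le_induction with
  | base => exact hk
  | succ l _ ih =>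
    intro i j
    obtain ⟨z, hz⟩ := exists_pos_of_mem_rowStochastic hA i
    rw [pow_succ', mul_apply]
    exact sum_pos' (fun y _ => mul_nonneg (nonneg_of_mem_rowStochastic hA) (ih y j).le)
      ⟨z, mem_univ z, mul_pos hz (ih z j)⟩

end Matrix

/-! ### The transition kernel and communication of the system -/

namespace RemoteSystem

variable {sys : RemoteSystem}

instance (m : Fin sys.M) : Nonempty (sys.SubState m) :=
  ⟨(⟨0, sys.N_pos m⟩, ⟨0, sys.N_pos m⟩)⟩

theorem subKernel_nonneg (m : Fin sys.M) (a : sys.Action) (x y : sys.SubState m) :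
    0 ≤ sys.subKernel m a x y := by
  have hq : 0 ≤ sys.Q m x.1 y.1 := Matrix.nonneg_of_mem_rowStochastic (sys.Q_stochastic m)
  have h1 := sys.ps_nonneg
  have h2 := sub_nonneg.2 sys.ps_le_one
  unfold subKernel
  split_ifs <;> positivity

theorem sum_subKernel (m : Fin sys.M) (a : sys.Action) (x : sys.SubState m) :
    ∑ y, sys.subKernel m a x y = 1 := by
  obtain ⟨i, j⟩ := x
  rw [Fintype.sum_prod_type, ← Matrix.sum_row_of_mem_rowStochastic (sys.Q_stochastic m) i]
  refine sum_congr rfl fun k _ => ?_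
  unfold subKernel
  by_cases ha : a = m.succ
  · by_cases hij : i = j
    · subst hij
      simp [ha]
    -- The outcomes of success and failure differ here, so the nested cases become a sum.
    · have h : ∀ l : Fin (sys.N m), (if l = i then sys.Q m i k * sys.ps
          else if l = j then sys.Q m i k * (1 - sys.ps) else 0) =
          (if l = i then sys.Q m i k * sys.ps else 0) +
            if l = j then sys.Q m i k * (1 - sys.ps) else 0 := fun l => by
        by_cases h1 : l = i
        · have : l ≠ j := fun h2 => hij (h1.symm.trans h2)
          simp [h1, hij]
        · simp [h1]
      simp only [ha, hij, ne_eq, not_false_eq_true, true_and, false_and, and_false, not_true,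
        if_false, h, sum_add_distrib, sum_ite_eq', mem_univ, if_true]
      ring
  · simp [ha]

theorem kernel_nonneg (s : sys.State) (a : sys.Action) (s' : sys.State) :
    0 ≤ sys.kernel s a s' :=
  prod_nonneg fun m _ => subKernel_nonneg m a (s m) (s' m)

theorem sum_kernel (s : sys.State) (a : sys.Action) : ∑ s', sys.kernel s a s' = 1 := by
  unfold kernel
  rw [← Fintype.prod_sum fun m y => sys.subKernel m a (s m) y]
  exact prod_eq_one fun m _ => sum_subKernel m a (s m)

theorem subKernel_pos_of_ne {m : Fin sys.M} {a : sys.Action} (ha : a ≠ m.succ)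
    {i k : Fin (sys.N m)} (j : Fin (sys.N m)) (hq : 0 < sys.Q m i k) :
    0 < sys.subKernel m a (i, j) (k, j) := by
  simpa [subKernel, ha] using hq

theorem subKernel_pos_of_transmit (hps : 0 < sys.ps) {m : Fin sys.M} {i k : Fin (sys.N m)}
    (j : Fin (sys.N m)) (hq : 0 < sys.Q m i k) :
    0 < sys.subKernel m m.succ (i, j) (k, i) := by
  by_cases hij : i = j
  · simpa [subKernel, hij] using hij ▸ hq
  · simpa [subKernel, hij] using mul_pos hq hps

variable (sys) in
/-- Some action leads from `s` to `s'` with positive probability. -/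
def CanMove (s s' : sys.State) : Prop := ∃ a, 0 < sys.kernel s a s'

/-- Idle for `n` slots: estimates persist and the sources move independently. The induction peels
off the last slot. -/
theorem reachable_of_pow_pos (n : ℕ) (s s' : sys.State) (hest : ∀ m, (s m).2 = (s' m).2)
    (hpow : ∀ m, 0 < (sys.Q m ^ n) (s m).1 (s' m).1) :
    Relation.ReflTransGen sys.CanMove s s' := by
  induction n generalizing s' with
  | zero =>
    have : s = s' := by
      funext m
      refine Prod.ext ?_ (hest m)
      have := hpow m
      rw [pow_zero, Matrix.one_apply] at this
      by_contra hne
      rw [if_neg hne] at this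
      exact this.false
    rw [this]
  | succ n ih =>
    have : ∀ m, ∃ z, 0 < (sys.Q m ^ n) (s m).1 z ∧ 0 < sys.Q m z (s' m).1 := by
      intro m
      have h := hpow m
      rw [pow_succ, Matrix.mul_apply] at h
      obtain ⟨z, -, hz⟩ := exists_lt_of_sum_lt (s := univ) (f := fun _ => (0 : ℝ)) (by simpa using h)
      have h1 : 0 ≤ (sys.Q m ^ n) (s m).1 z :=
        Matrix.nonneg_of_mem_rowStochastic (pow_mem (sys.Q_stochastic m) n)
      exact ⟨z, pos_of_mul_pos_left hz
        (Matrix.nonneg_of_mem_rowStochastic (sys.Q_stochastic m)), pos_of_mul_pos_right hz h1⟩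
    choose z hz1 hz2 using this
    refine (ih (fun m => (z m, (s' m).2)) hest hz1).tail ⟨0, prod_pos fun m _ => ?_⟩
    exact subKernel_pos_of_ne (Fin.succ_ne_zero m).symm _ (hz2 m)

/-- While no source is sampled, the joint source process can move anywhere. -/
theorem reachable_of_estimate_eq (hQ : ∀ m, (sys.Q m).IsPrimitive) (s s' : sys.State)
    (hest : ∀ m, (s m).2 = (s' m).2) : Relation.ReflTransGen sys.CanMove s s' := by
  choose k hk using fun m => (hQ m).exists_forall_pow_pos (sys.Q_stochastic m)
  exact reachable_of_pow_pos (∑ m, k m) s s' hest fun m =>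
    hk m _ (single_le_sum (fun _ _ => Nat.zero_le _) (mem_univ m)) _ _

theorem exists_reachable_update_estimate (hQ : ∀ m, (sys.Q m).IsPrimitive) (hps : 0 < sys.ps)
    (s : sys.State) (m : Fin sys.M) (j : Fin (sys.N m)) :
    ∃ s', Relation.ReflTransGen sys.CanMove s s' ∧ (s' m).2 = j ∧
      ∀ l, l ≠ m → (s' l).2 = (s l).2 := by
  classical
  choose y hy using fun l (i : Fin (sys.N l)) =>
    Matrix.exists_pos_of_mem_rowStochastic (sys.Q_stochastic l) i
  -- In `t` the state of source `m` is the wanted estimate `j`. It is reached by idling, and one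
  -- successful transmission then delivers it.
  let t : sys.State := fun l => (if h : l = m then h ▸ j else (s l).1, (s l).2)
  have htm : (t m).1 = j := by simp [t]
  let s' : sys.State := fun l => (y l (t l).1, if l = m then (t l).1 else (t l).2)
  refine ⟨s', (reachable_of_estimate_eq hQ s t fun _ => rfl).tail ⟨m.succ, prod_pos fun l _ => ?_⟩,
    by simp [s', htm], fun l hl => by simp [s', hl, t]⟩
  by_cases hl : l = m
  · subst hl
    simpa [s'] using subKernel_pos_of_transmit hps (t l).2 (hy l (t l).1)
  · have hne : m.succ ≠ l.succ := fun h => hl (Fin.succ_injective _ h).symm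
    simpa [s', hl] using subKernel_pos_of_ne hne (t l).2 (hy l (t l).1)

/-- The system is communicating. -/
theorem reachable (hQ : ∀ m, (sys.Q m).IsPrimitive) (hps : 0 < sys.ps) (s s' : sys.State) :
    Relation.ReflTransGen sys.CanMove s s' := by
  classical
  have key : ∀ I : Finset (Fin sys.M), ∃ t, Relation.ReflTransGen sys.CanMove s t ∧
      ∀ m ∈ I, (t m).2 = (s' m).2 := by
    intro I
    induction I using Finset.induction_on with
    | empty => exact ⟨s, .refl, by simp⟩
    | insert m I hm ih =>
      obtain ⟨t, ht, hI⟩ := ih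
      obtain ⟨u, hu, hum, hul⟩ := exists_reachable_update_estimate hQ hps t m (s' m).2
      refine ⟨u, ht.trans hu, fun l hl => ?_⟩
      rcases eq_or_ne l m with rfl | hne
      · exact hum
      · rw [hul l hne, hI l ((mem_insert.1 hl).resolve_left hne)]
  obtain ⟨t, ht, h⟩ := key univ
  exact ht.trans (reachable_of_estimate_eq hQ t s' fun m => h m (mem_univ m))

end RemoteSystem

/-! ### Average costs and the verification argument -/

theorem tendsto_sub_div_atTop_of_abs_le {v : ℕ → ℝ} {B : ℝ} (hv : ∀ n, |v n| ≤ B) :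
    Tendsto (fun T : ℕ => (v 0 - v T) / (T : ℝ)) atTop (nhds 0) := by
  have h1 : Tendsto (fun T : ℕ => 2 * B / (T : ℝ)) atTop (nhds 0) :=
    tendsto_const_div_atTop_nhds_zero_nat _
  refine squeeze_zero_norm (fun T => ?_) h1
  rw [Real.norm_eq_abs, abs_div, Nat.abs_cast]
  gcongr
  have := abs_sub (v 0) (v T)
  linarith [hv 0, hv T]

/-- Telescoping: Cesàro means of `L + v t - v (t + 1)` converge to `L` when `v` is bounded. -/
theorem tendsto_average_telescope {v : ℕ → ℝ} {B : ℝ} (hv : ∀ n, |v n| ≤ B) (L : ℝ) :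
    Tendsto (fun T : ℕ => (∑ t ∈ range T, (L + (v t - v (t + 1)))) / (T : ℝ)) atTop (nhds L) := by
  have h := (tendsto_sub_div_atTop_of_abs_le hv).const_add L
  rw [add_zero] at h
  refine h.congr' ?_
  filter_upwards [eventually_gt_atTop 0] with T hT
  have : (T : ℝ) ≠ 0 := by exact_mod_cast hT.ne'
  rw [sum_add_distrib, sum_range_sub', sum_const, card_range, nsmul_eq_mul, add_div,
    mul_div_cancel_left₀ _ this]

namespace RemoteSystem

variable {sys : RemoteSystem}

namespace Policy

variable (π : sys.Policy)

/-- Expectation of `f` at the state reached after `t` transitions. -/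
def expVal (f : sys.State → ℝ) (s : sys.State) (t : ℕ) : ℝ :=
  ∑ h : sys.Hist t, π.law s t h * f (sys.cur t h)

theorem law_nonneg (s : sys.State) (t : ℕ) (h : sys.Hist t) : 0 ≤ π.law s t h := by
  induction t with
  | zero => unfold law; split_ifs <;> norm_num
  | succ t ih =>
    obtain ⟨h, a, s'⟩ := h
    exact mul_nonneg (mul_nonneg (ih h) (π.prob_nonneg t h a)) (kernel_nonneg _ _ _)

theorem expCost_eq (g : sys.State → sys.Action → sys.State → ℝ) (s : sys.State) (t : ℕ) :
    π.expCost g s t = ∑ h : sys.Hist t, ∑ a, π.law s t h * π.prob t h a *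
      ∑ s', sys.kernel (sys.cur t h) a s' * g (sys.cur t h) a s' := by
  unfold expCost
  simp only [mul_sum, mul_assoc]

theorem expVal_succ (f : sys.State → ℝ) (s : sys.State) (t : ℕ) :
    π.expVal f s (t + 1) = π.expCost (fun _ _ s' => f s') s t := by
  change ∑ x : sys.Hist t × sys.Action × sys.State, _ = _
  rw [Fintype.sum_prod_type]
  refine sum_congr rfl fun h _ => ?_
  rw [Fintype.sum_prod_type]
  rfl

theorem expCost_state (f : sys.State → ℝ) (s : sys.State) (t : ℕ) :
    π.expCost (fun s _ _ => f s) s t = π.expVal f s t := by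
  rw [expCost_eq]
  refine sum_congr rfl fun h _ => ?_
  simp only [← sum_mul, sum_kernel, one_mul, ← mul_sum, π.prob_sum, mul_one]

theorem expCost_add (g g' : sys.State → sys.Action → sys.State → ℝ) (s : sys.State) (t : ℕ) :
    π.expCost (fun s a s' => g s a s' + g' s a s') s t = π.expCost g s t + π.expCost g' s t := by
  simp only [expCost, mul_add, sum_add_distrib]

theorem expCost_const_mul (c : ℝ) (g : sys.State → sys.Action → sys.State → ℝ) (s : sys.State)
    (t : ℕ) : π.expCost (fun s a s' => c * g s a s') s t = c * π.expCost g s t := by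
  simp only [expCost, mul_sum]
  refine sum_congr rfl fun h _ => sum_congr rfl fun a _ => sum_congr rfl fun s' _ => ?_
  ring

/-- Only actions of nonzero probability need comparing, so for a deterministic policy the Bellman
equality is used at its own action alone. -/
theorem expCost_le_of_forall {g g' : sys.State → sys.Action → sys.State → ℝ} (s : sys.State)
    (t : ℕ) (hg : ∀ h a, π.prob t h a ≠ 0 →
      ∑ s', sys.kernel (sys.cur t h) a s' * g (sys.cur t h) a s' ≤
        ∑ s', sys.kernel (sys.cur t h) a s' * g' (sys.cur t h) a s') :
    π.expCost g s t ≤ π.expCost g' s t := by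
  rw [expCost_eq, expCost_eq]
  refine sum_le_sum fun h _ => sum_le_sum fun a _ => ?_
  by_cases h0 : π.prob t h a = 0
  · simp [h0]
  · exact mul_le_mul_of_nonneg_left (hg h a h0)
      (mul_nonneg (π.law_nonneg s t h) (π.prob_nonneg t h a))

theorem expVal_const (c : ℝ) (s : sys.State) (t : ℕ) : π.expVal (fun _ => c) s t = c := by
  induction t with
  | zero =>
    change ∑ h : sys.State, (if h = s then (1 : ℝ) else 0) * c = c
    simp
  | succ t ih => rw [expVal_succ, π.expCost_state (fun _ => c), ih]

theorem expCost_le_of_le {g : sys.State → sys.Action → sys.State → ℝ} {B : ℝ}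
    (hg : ∀ s a s', g s a s' ≤ B) (s : sys.State) (t : ℕ) : π.expCost g s t ≤ B := by
  refine (π.expCost_le_of_forall s t (g' := fun _ _ _ => B) fun h a _ => sum_le_sum fun s' _ =>
    mul_le_mul_of_nonneg_left (hg _ _ _) (kernel_nonneg _ _ _)).trans_eq ?_
  rw [π.expCost_state (fun _ => B), expVal_const]

theorem le_expCost_of_le {g : sys.State → sys.Action → sys.State → ℝ} {B : ℝ}
    (hg : ∀ s a s', B ≤ g s a s') (s : sys.State) (t : ℕ) : B ≤ π.expCost g s t := by
  refine Eq.trans_le ?_ (π.expCost_le_of_forall s t (g := fun _ _ _ => B) fun h a _ =>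
    sum_le_sum fun s' _ => mul_le_mul_of_nonneg_left (hg _ _ _) (kernel_nonneg _ _ _))
  rw [π.expCost_state (fun _ => B), expVal_const]

theorem abs_expCost_le {g : sys.State → sys.Action → sys.State → ℝ} {B : ℝ}
    (hg : ∀ s a s', |g s a s'| ≤ B) (s : sys.State) (t : ℕ) : |π.expCost g s t| ≤ B :=
  abs_le.2 ⟨π.le_expCost_of_le (fun s a s' => (abs_le.1 (hg s a s')).1) s t,
    π.expCost_le_of_le (fun s a s' => (abs_le.1 (hg s a s')).2) s t⟩

theorem exists_forall_abs_expVal_le (f : sys.State → ℝ) (s : sys.State) :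
    ∃ B, ∀ t, |π.expVal f s t| ≤ B := by
  refine ⟨∑ s, |f s|, fun t => ?_⟩
  rw [← expCost_state]
  exact π.abs_expCost_le (fun x _ _ => single_le_sum (f := fun x => |f x|)
    (fun _ _ => abs_nonneg _) (mem_univ x)) s t

theorem exists_forall_expCost_le (g : sys.State → sys.Action → sys.State → ℝ) :
    ∃ B, ∀ s t, π.expCost g s t ≤ B := by
  obtain ⟨B, hB⟩ := (Set.finite_range fun x : sys.State × sys.Action × sys.State =>
    g x.1 x.2.1 x.2.2).bddAbove
  exact ⟨B, π.expCost_le_of_le fun s a s' => hB ⟨(s, a, s'), rfl⟩⟩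

/-- The expected cost averaged over the first `T` transitions. -/
noncomputable def meanCost (g : sys.State → sys.Action → sys.State → ℝ) (s : sys.State) (T : ℕ) : ℝ :=
  (∑ t ∈ range T, π.expCost g s t) / (T : ℝ)

theorem isBoundedUnder_meanCost (g : sys.State → sys.Action → sys.State → ℝ) (s : sys.State) :
    IsBoundedUnder (· ≤ ·) atTop (π.meanCost g s) := by
  obtain ⟨B, hB⟩ := π.exists_forall_expCost_le g
  -- The mean over `T = 0` transitions is `0`, which `B` itself might not bound.
  refine ⟨|B|, eventually_map.2 (Eventually.of_forall fun T => ?_)⟩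
  refine div_le_of_le_mul₀ (Nat.cast_nonneg _) (abs_nonneg _) ?_
  calc ∑ t ∈ range T, π.expCost g s t ≤ ∑ _t ∈ range T, |B| :=
        sum_le_sum fun t _ => (hB s t).trans (le_abs_self B)
    _ = |B| * T := by simp [mul_comm]

theorem avgCost_eq_of_tendsto {g : sys.State → sys.Action → sys.State → ℝ} {s : sys.State} {c : ℝ}
    (h : Tendsto (π.meanCost g s) atTop (nhds c)) : π.avgCost g s = c :=
  h.limsup_eq

theorem expCost_bellman (g : sys.State → sys.Action → sys.State → ℝ) (h : sys.State → ℝ)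
    (s : sys.State) (t : ℕ) :
    π.expCost (fun s a s' => g s a s' + h s') s t = π.expCost g s t + π.expVal h s (t + 1) := by
  rw [expVal_succ, expCost_add]

theorem expCost_const_add (c : ℝ) (h : sys.State → ℝ) (s : sys.State) (t : ℕ) :
    π.expCost (fun s _ _ => c + h s) s t = c + π.expVal h s t := by
  rw [π.expCost_add (fun _ _ _ => c) (fun s _ _ => h s), π.expCost_state h,
    π.expCost_state (fun _ => c), expVal_const]

theorem sum_kernel_mul_const (s : sys.State) (a : sys.Action) (c : ℝ) :
    ∑ s', sys.kernel s a s' * c = c := by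
  rw [← sum_mul, sum_kernel, one_mul]

/-- The Bellman inequality bounds the average cost of every policy from below. -/
theorem le_avgL_of_le_bellmanQ {lam L : ℝ} {h : sys.State → ℝ}
    (hle : ∀ s a, L + h s ≤ sys.bellmanQ lam h s a) (s : sys.State) : L ≤ π.avgL lam s := by
  obtain ⟨B, hB⟩ := π.exists_forall_abs_expVal_le h s
  have ht := tendsto_average_telescope hB L
  rw [← ht.limsup_eq]
  refine limsup_le_limsup (Eventually.of_forall fun T => ?_) ht.isCoboundedUnder_le
    (π.isBoundedUnder_meanCost (sys.lagCost lam) s)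
  refine div_le_div_of_nonneg_right (sum_le_sum fun t _ => ?_) (Nat.cast_nonneg _)
  have h1 := π.expCost_le_of_forall s t (g := fun s _ _ => L + h s)
    (g' := fun s a s' => sys.lagCost lam s a s' + h s') fun x a _ => by
      rw [sum_kernel_mul_const]; exact hle _ _
  rw [expCost_bellman, expCost_const_add] at h1
  linarith

end Policy

/-- Under a policy attaining the minimum in the Bellman equation, the mean cost converges. -/
theorem MDPolicy.tendsto_meanCost_of_eq_bellmanQ {π : sys.MDPolicy} {lam L : ℝ}
    {h : sys.State → ℝ} (heq : ∀ s, L + h s = sys.bellmanQ lam h s (π s)) (s : sys.State) :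
    Tendsto (π.toPolicy.meanCost (sys.lagCost lam) s) atTop (nhds L) := by
  obtain ⟨B, hB⟩ := π.toPolicy.exists_forall_abs_expVal_le h s
  refine (tendsto_average_telescope hB L).congr fun T => ?_
  unfold Policy.meanCost
  congr 1
  refine sum_congr rfl fun t _ => ?_
  have hact : ∀ (x : sys.Hist t) a, π.toPolicy.prob t x a ≠ 0 → a = π (sys.cur t x) := by
    intro x a hx
    by_contra hne
    exact hx (if_neg hne)
  have hsum : ∀ (x : sys.Hist t) a, π.toPolicy.prob t x a ≠ 0 →
      ∑ s', sys.kernel (sys.cur t x) a s' * (L + h (sys.cur t x)) =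
        ∑ s', sys.kernel (sys.cur t x) a s' * (sys.lagCost lam (sys.cur t x) a s' + h s') := by
    intro x a hx
    rw [Policy.sum_kernel_mul_const, hact x a hx]
    exact heq _
  -- The comparison is applied in both directions to obtain equality of expectations.
  have h1 := π.toPolicy.expCost_le_of_forall s t (g := fun s _ _ => L + h s)
    (g' := fun s a s' => sys.lagCost lam s a s' + h s') fun x a hx => (hsum x a hx).le
  have h2 := π.toPolicy.expCost_le_of_forall s t (g' := fun s _ _ => L + h s)
    (g := fun s a s' => sys.lagCost lam s a s' + h s') fun x a hx => (hsum x a hx).ge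
  rw [Policy.expCost_bellman, Policy.expCost_const_add] at h1 h2
  linarith

/-- Affinity in the multiplier is exact for finite horizons, whereas limsups are only subadditive;
the costs are therefore separated before passing to the limit. -/
theorem Policy.meanCost_lagCost (π : sys.Policy) (lam : ℝ) (s : sys.State) (T : ℕ) :
    π.meanCost (sys.lagCost lam) s T =
      π.meanCost sys.actCost s T + lam * π.meanCost sys.txCost s T := by
  have h : ∀ t, π.expCost (sys.lagCost lam) s t =
      π.expCost sys.actCost s t + lam * π.expCost sys.txCost s t := fun t => by
    rw [← π.expCost_const_mul, ← π.expCost_add]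
    rfl
  simp only [Policy.meanCost, h, sum_add_distrib, ← mul_sum, add_div, mul_div_assoc]

/-! ### Bellman solutions and separation of the two costs -/

theorem IsBellmanSolution.le {lam L : ℝ} {h : sys.State → ℝ} (hs : sys.IsBellmanSolution lam L h)
    (s : sys.State) (a : sys.Action) : L + h s ≤ sys.bellmanQ lam h s a := by
  rw [hs s]
  exact inf'_le _ (mem_univ a)

theorem IsBellmanSolution.eq_of_isBellmanSelector {lam L : ℝ} {h : sys.State → ℝ}
    (hs : sys.IsBellmanSolution lam L h) {π : sys.MDPolicy}
    (hπ : sys.IsBellmanSelector lam h π) (s : sys.State) :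
    L + h s = sys.bellmanQ lam h s (π s) :=
  le_antisymm (hs.le s _) (by rw [hs s]; exact le_inf' _ _ fun a _ => hπ s a)

theorem exists_isBellmanSelector (lam : ℝ) (h : sys.State → ℝ) :
    ∃ π : sys.MDPolicy, sys.IsBellmanSelector lam h π := by
  choose π hπ using fun s => Finite.exists_min (sys.bellmanQ lam h s)
  exact ⟨π, hπ⟩

theorem isBellmanSolution_of_eq {lam L : ℝ} {h : sys.State → ℝ} {π : sys.MDPolicy}
    (heq : ∀ s, L + h s = sys.bellmanQ lam h s (π s))
    (hle : ∀ s a, L + h s ≤ sys.bellmanQ lam h s a) : sys.IsBellmanSolution lam L h := fun s =>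
  le_antisymm (le_inf' _ _ fun a _ => hle s a) (by rw [heq s]; exact inf'_le _ (mem_univ _))

theorem bellmanQ_eq (lam : ℝ) (h : sys.State → ℝ) (s : sys.State) (a : sys.Action) :
    sys.bellmanQ lam h s a = (∑ s', sys.kernel s a s' * sys.actCost s a s' +
      lam * ∑ s', sys.kernel s a s' * sys.txCost s a s') + ∑ s', sys.kernel s a s' * h s' := by
  unfold bellmanQ lagCost
  rw [mul_sum, ← sum_add_distrib, ← sum_add_distrib]
  refine sum_congr rfl fun s' _ => ?_
  ring

/-- The Bellman equation has a solution with a minimizing policy that also minimizes in the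
Bellman equations of two other distinct multipliers. -/
theorem exists_isBellmanSolution (hQ : ∀ m, (sys.Q m).IsPrimitive) (hps : 0 < sys.ps) (lam : ℝ) :
    ∃ (π : sys.MDPolicy) (lam' : Fin 2 → ℝ) (L' : Fin 2 → ℝ) (h' : Fin 2 → sys.State → ℝ)
      (L : ℝ) (h : sys.State → ℝ), lam' 0 ≠ lam' 1 ∧
      (∀ i s, L' i + h' i s = sys.bellmanQ (lam' i) (h' i) s (π s)) ∧
      (∀ s, L + h s = sys.bellmanQ lam h s (π s)) ∧
      ∀ s a, L + h s ≤ sys.bellmanQ lam h s a := by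
  obtain ⟨K, -, hex⟩ := exists_bellman (P := sys.kernel) kernel_nonneg sum_kernel
    (reachable hQ hps)
  let c : sys.State → sys.Action → ℝ := fun s a => ∑ s', sys.kernel s a s' * sys.actCost s a s'
  let f : sys.State → sys.Action → ℝ := fun s a => ∑ s', sys.kernel s a s' * sys.txCost s a s'
  let μ : ℕ → ℝ := fun n => lam + 1 / ((n : ℝ) + 1)
  have hμt : Tendsto μ atTop (nhds lam) := by
    simpa only [add_zero] using
      (tendsto_one_div_add_atTop_nhds_zero_nat (𝕜 := ℝ)).const_add lam
  have hμ : ∀ n, |μ n| ≤ |lam| + 1 := fun n => by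
    refine (abs_add_le _ _).trans (add_le_add le_rfl ?_)
    rw [abs_of_pos (by positivity), div_le_one (by positivity)]
    linarith [n.cast_nonneg (α := ℝ)]
  have hμinj : Function.Injective μ := fun m n hmn => by
    have : 1 / ((m : ℝ) + 1) = 1 / ((n : ℝ) + 1) := add_left_cancel hmn
    have h1 : (m : ℝ) + 1 = n + 1 := by simpa using this
    exact_mod_cast add_right_cancel h1
  -- Since `|μ n| ≤ |lam| + 1`, this bounds the Lagrangian costs for all `n` at once, and hence all
  -- the solutions.
  obtain ⟨B, hB⟩ := (Set.finite_range fun x : sys.State × sys.Action =>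
    |c x.1 x.2| + (|lam| + 1) * |f x.1 x.2|).bddAbove
  have hr : ∀ n s a, |c s a + μ n * f s a| ≤ B := fun n s a => by
    refine ((abs_add_le _ _).trans ?_).trans (hB ⟨(s, a), rfl⟩)
    rw [abs_mul]
    exact add_le_add le_rfl (mul_le_mul_of_nonneg_right (hμ n) (abs_nonneg _))
  choose Ls hs ps hL hh heq hle using fun n => hex (fun s a => c s a + μ n * f s a) B (hr n)
  let U : Ultrafilter ℕ := hyperfilter ℕ
  have hU : (U : Filter ℕ) ≤ atTop := Nat.hyperfilter_le_atTop
  obtain ⟨L, -, hLt⟩ := exists_tendsto_ultrafilter_of_abs_le U hL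
  choose h _ hht using fun s => exists_tendsto_ultrafilter_of_abs_le U fun n => hh n s
  obtain ⟨π, hπ⟩ := U.exists_eventually_eq_of_finite ps
  -- A set in the hyperfilter is infinite, so the limiting policy serves at least two indices, whose
  -- multipliers differ by injectivity of `μ`.
  have hinf : {n | ps n = π}.Infinite := fun hfin => notMem_hyperfilter_of_finite hfin hπ
  obtain ⟨m, hm, n, hn, hmn⟩ := hinf.nontrivial
  have hlhs : ∀ s, Tendsto (fun n => Ls n + hs n s) U (nhds (L + h s)) := fun s =>
    hLt.add (hht s)
  have hrhs : ∀ s a, Tendsto (fun n => c s a + μ n * f s a + ∑ y, sys.kernel s a y * hs n y) U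
      (nhds (sys.bellmanQ lam h s a)) := fun s a => by
    rw [bellmanQ_eq]
    exact (((hμt.mono_left hU).mul_const _).const_add _).add
      (tendsto_finsetSum _ fun y _ => (hht y).const_mul _)
  have key : ∀ k, ps k = π → ∀ s, Ls k + hs k s = sys.bellmanQ (μ k) (hs k) s (π s) := by
    intro k hk s
    rw [bellmanQ_eq, ← hk]
    exact heq k s
  refine ⟨π, ![μ m, μ n], ![Ls m, Ls n], ![hs m, hs n], L, h, hμinj.ne hmn, fun i => ?_,
    fun s => ?_, fun s a => le_of_tendsto_of_tendsto' (hlhs s) (hrhs s a) fun n => hle n s a⟩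
  · fin_cases i
    · exact key m hm
    · exact key n hn
  · refine tendsto_nhds_unique_of_eventuallyEq (hlhs s) (hrhs s (π s)) ?_
    filter_upwards [hπ] with n hn
    have := heq n s
    rwa [hn] at this

/-- If the mean Lagrangian costs converge to constants for two distinct multipliers, so do the mean
costs of both kinds. -/
theorem Policy.exists_tendsto_meanCost {π : sys.Policy} {lam L : Fin 2 → ℝ}
    (hne : lam 0 ≠ lam 1)
    (ht : ∀ i s, Tendsto (π.meanCost (sys.lagCost (lam i)) s) atTop (nhds (L i))) :
    ∃ C F, ∀ s, Tendsto (π.meanCost sys.actCost s) atTop (nhds C) ∧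
      Tendsto (π.meanCost sys.txCost s) atTop (nhds F) := by
  have hF : ∀ s, Tendsto (π.meanCost sys.txCost s) atTop
      (nhds ((L 0 - L 1) / (lam 0 - lam 1))) := fun s => by
    -- Subtracting the two Lagrangian means eliminates the actuation cost.
    refine (((ht 0 s).sub (ht 1 s)).div_const (lam 0 - lam 1)).congr fun T => ?_
    have := sub_ne_zero.2 hne
    simp only [meanCost_lagCost]
    field_simp
    ring
  refine ⟨L 0 - lam 0 * ((L 0 - L 1) / (lam 0 - lam 1)), _, fun s => ⟨?_, hF s⟩⟩
  refine ((ht 0 s).sub ((hF s).const_mul (lam 0))).congr fun T => ?_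
  simp only [meanCost_lagCost]
  ring

end RemoteSystem

/-! ### The main theorem -/

theorem theorem1 (sys : RemoteSystem)
    (hQ : ∀ m, (sys.Q m).IsPrimitive)
    (hps : 0 < sys.ps)
    (lam : ℝ) (hlam : 0 ≤ lam) :
    (∃ (L C F : ℝ) (h : sys.State → ℝ) (π : sys.MDPolicy),
      sys.IsBellmanSolution lam L h ∧
      sys.IsBellmanSelector lam h π ∧
      π.toPolicy.IsLambdaOptimal lam ∧
      (∀ s, π.toPolicy.avgL lam s = L ∧ π.toPolicy.avgC s = C ∧ π.toPolicy.avgF s = F) ∧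
      L = C + lam * F) ∧
    (∀ (L : ℝ) (h : sys.State → ℝ), sys.IsBellmanSolution lam L h →
      (∀ s, IsLeast (Set.range fun π : sys.Policy => π.avgL lam s) L) ∧
      ∀ π : sys.MDPolicy, sys.IsBellmanSelector lam h π →
        ∀ s, π.toPolicy.avgL lam s = L) := by
  constructor
  · obtain ⟨π, lam', L', h', L, h, hne, heq', heq, hle⟩ :=
      RemoteSystem.exists_isBellmanSolution hQ hps lam
    have htL := RemoteSystem.MDPolicy.tendsto_meanCost_of_eq_bellmanQ heq
    obtain ⟨C, F, hCF⟩ := RemoteSystem.Policy.exists_tendsto_meanCost hne fun i =>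
      RemoteSystem.MDPolicy.tendsto_meanCost_of_eq_bellmanQ (heq' i)
    have hL : ∀ s, π.toPolicy.avgL lam s = L := fun s =>
      π.toPolicy.avgCost_eq_of_tendsto (htL s)
    have hC : ∀ s, π.toPolicy.avgC s = C := fun s =>
      π.toPolicy.avgCost_eq_of_tendsto (hCF s).1
    have hF : ∀ s, π.toPolicy.avgF s = F := fun s =>
      π.toPolicy.avgCost_eq_of_tendsto (hCF s).2
    obtain ⟨s₀⟩ : Nonempty sys.State := inferInstance
    refine ⟨L, C, F, h, π, RemoteSystem.isBellmanSolution_of_eq heq hle,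
      fun s a => (heq s).symm.trans_le (hle s a),
      ⟨fun s π' => (hL s).trans_le (π'.le_avgL_of_le_bellmanQ hle s), fun s s' => by simp only [hL],
        fun s s' => by simp only [hC], fun s s' => by simp only [hF]⟩,
      fun s => ⟨hL s, hC s, hF s⟩, ?_⟩
    -- The Lagrangian means converge both to `L` and, by affinity, to `C + lam * F`.
    refine tendsto_nhds_unique (htL s₀) ?_
    refine ((hCF s₀).1.add ((hCF s₀).2.const_mul lam)).congr fun T => ?_
    rw [RemoteSystem.Policy.meanCost_lagCost]
  · intro L h hs
    have hsel : ∀ π : sys.MDPolicy, sys.IsBellmanSelector lam h π →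
        ∀ s, π.toPolicy.avgL lam s = L := fun π hπ s =>
      π.toPolicy.avgCost_eq_of_tendsto (RemoteSystem.MDPolicy.tendsto_meanCost_of_eq_bellmanQ
        (hs.eq_of_isBellmanSelector hπ) s)
    refine ⟨fun s => ⟨?_, ?_⟩, hsel⟩
    · obtain ⟨π, hπ⟩ := RemoteSystem.exists_isBellmanSelector lam h
      exact ⟨π.toPolicy, hsel π hπ s⟩
    · rintro _ ⟨π, rfl⟩
      exact π.le_avgL_of_le_bellmanQ hs.le s
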